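/- Let $D$ be a bounded domain in $\mathbb C^n$ and let $p\in\partial D$ be such that $D$ has $C^1$ boundary near $p$ (that is, near $p$ the set $D$ is $\{\rho<0\}$ for a real $C^1$ function $\rho$ with $d\rho\neq 0$). For $q\in D$ let $\delta_D(q)$ be the Euclidean distance from $q$ to $\partial D$, and for $X\in\mathbb C^n$ let $$S_D(q;X):=\sup_v\,[\mathcal L_v(q;X)]^{1/2},\qquad \mathcal L_v(q;X)=\sum_{j,k}\frac{\partial^2 v}{\partial z_j\partial\bar z_k}(q)X_j\overline{X_k},$$ be the Sibony metric, where the supremum runs over all functions $v:D\to[0,1)$ such that $v(q)=0$, $\log v$ is plurisubharmonic on $D$, and $v$ is of class $C^2$ near $q$. Let $p_q\in\partial D$ be any point with $\|q-p_q\|=\delta_D(q)$. Let $L_q$ be the complex line through $q$ and $p_q$, and let $H_{q^*}$ be the complex hyperplane through $q^*:=2p_q-q$ orthogonal to $L_q$. Set $$\delta^*_D(q):=\min\bigl(1,\ \operatorname{dist}(q^*,\overline D\cap H_{q^*})\bigr),$$ where the distance to the empty set is $+\infty$. Then there exist a constant $c>0$ and a neighbourhood $U$ of $p$ such that for every $q\in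 D\cap U$, every such choice of $p_q$, and every $X\in\mathbb C^n$, $$c\,S_D(q;X)\ \ge\ \frac{\delta^*_D(q)}{\delta_D(q)}\,\|X_q\|+\|X\|,$$ where $X_q$ is the orthogonal projection of the vector $X$ onto (the direction of) $L_q$. -/

import Mathlib

open Set Filter Topology MeasureTheory
open scoped ENNReal

noncomputable section

/-- Complex Euclidean space of dimension `n`, with the Hermitian norm. -/
abbrev CSpace (n : ℕ) : Type := EuclideanSpace ℂ (Fin n)

/-- The mean over the unit circle of a function with values in the extended reals:
mean of the positive part minus mean of the negative part. (For an upper semicontinuous function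
that is `< ⊤`, the first of the two is finite.) -/
def unitCircleMean (g : ℂ → EReal) : EReal :=
  ((ENNReal.ofReal (2 * Real.pi)⁻¹ *
      ∫⁻ t in Ioc (0 : ℝ) (2 * Real.pi), (g (Complex.exp (t * Complex.I))).toENNReal : ℝ≥0∞) : EReal)
  - ((ENNReal.ofReal (2 * Real.pi)⁻¹ *
      ∫⁻ t in Ioc (0 : ℝ) (2 * Real.pi), (-g (Complex.exp (t * Complex.I))).toENNReal : ℝ≥0∞) : EReal)

/-- `u : D → [-∞, ∞)` is plurisubharmonic on the open set `D`: it is upper semicontinuous and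
satisfies the sub-mean value inequality on every closed complex disc contained in `D`.
(The function identically `-∞` is allowed.) -/
def IsPlurisubharmonicOn {n : ℕ} (u : CSpace n → EReal) (D : Set (CSpace n)) : Prop :=
  (∀ z ∈ D, u z < ⊤) ∧
  UpperSemicontinuousOn u D ∧
  ∀ a b : CSpace n, (∀ l : ℂ, ‖l‖ ≤ 1 → a + l • b ∈ D) →
    u a ≤ unitCircleMean (fun l => u (a + l • b))

/-- The Levi form `∑ⱼₖ (∂²v/∂zⱼ∂z̄ₖ)(z) Xⱼ X̄ₖ`, which is the value at `l = 0` of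
`∂²/∂l∂l̄ v(z + l X)`, i.e. a quarter of the Laplacian at `0` of `l ↦ v(z + l X)`. -/
def leviForm {n : ℕ} (v : CSpace n → ℝ) (z X : CSpace n) : ℝ :=
  (fderiv ℝ (fderiv ℝ v) z X X
    + fderiv ℝ (fderiv ℝ v) z (Complex.I • X) (Complex.I • X)) / 4

/-- The competitors for the Sibony metric of `D` at `z`: functions `v : D → [0,1)` with `v z = 0`,
with `log v` plurisubharmonic on `D` (where `log 0 = -∞`), and of class `C²` near `z`.
Only the values of `v` on `D` matter. -/
def sibonyClass {n : ℕ} (D : Set (CSpace n)) (z : CSpace n) : Set (CSpace n → ℝ) :=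
  {v | MapsTo v D (Ico 0 1) ∧ v z = 0 ∧
    IsPlurisubharmonicOn (fun w => ENNReal.log (ENNReal.ofReal (v w))) D ∧
    ContDiffAt ℝ 2 v z}

/-- The Sibony metric `S_D(z; X)`, the supremum of `L_v(z; X)^{1/2}`, taken in `[0, ∞]`. -/
def sibonyMetric {n : ℕ} (D : Set (CSpace n)) (z X : CSpace n) : ℝ≥0∞ :=
  ⨆ v ∈ sibonyClass D z, ENNReal.ofReal (Real.sqrt (leviForm v z X))

/-- `D` has `C¹` boundary near the boundary point `p`: in an open neighbourhood `U` of `p`, the set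
`D` is `{ρ < 0}` for a real `C¹` function `ρ` without critical points. -/
def HasC1BoundaryNear {n : ℕ} (D : Set (CSpace n)) (p : CSpace n) : Prop :=
  ∃ (U : Set (CSpace n)) (ρ : CSpace n → ℝ), IsOpen U ∧ p ∈ U ∧ ContDiffOn ℝ 1 ρ U ∧
    (∀ z ∈ U, fderiv ℝ ρ z ≠ 0) ∧ D ∩ U = {z ∈ U | ρ z < 0}

/-- The distance `δ_D(q)` from `q` to the boundary of `D`. -/
def bdryDist {n : ℕ} (D : Set (CSpace n)) (q : CSpace n) : ℝ :=
  Metric.infDist q (frontier D)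

/-- The direction of the complex line `L_q` through `q` and `p_q`. -/
def normalLine {n : ℕ} (q pq : CSpace n) : Submodule ℂ (CSpace n) :=
  Submodule.span ℂ {pq - q}

/-- The reflected point `q* = 2 p_q - q`. -/
def reflectedPoint {n : ℕ} (q pq : CSpace n) : CSpace n := (2 : ℂ) • pq - q

/-- The complex hyperplane `H_{q*}` through `q*` orthogonal to `L_q`. -/
def reflectedHyperplane {n : ℕ} (q pq : CSpace n) : Set (CSpace n) :=
  {w | w - reflectedPoint q pq ∈ (normalLine q pq)ᗮ}

/-- `δ*_D(q) = min (1, dist (q*, closure D ∩ H_{q*}))`, where the distance to the empty set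
is infinite. It depends on the chosen nearest boundary point `p_q`. -/
def starDist {n : ℕ} (D : Set (CSpace n)) (q pq : CSpace n) : ℝ :=
  (min 1 (Metric.infEDist (reflectedPoint q pq)
    (closure D ∩ reflectedHyperplane q pq))).toReal

end

/-! It suffices to exhibit, for each `q` near `p`, one competitor `v` with a large Levi form at `q`.
Put `e = p_q - q`. The affine function `1 - ⟨e, z - q⟩ / (2‖e‖²)` is `1` at `q` and vanishes exactly
on `H_{q*}`. If it took a value in `(-∞, 0]` at a point `z ∈ D` with `‖z - q‖ < δ*`, then sliding
`z` along `-e` would reach `H_{q*}` without leaving `D`, because the boundary is `C¹`, at a point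
closer than `δ*` to `q*`: a contradiction (`exists_ball_translate_mem`,
`one_sub_inner_mem_slitPlane`). Hence it maps `D ∩ B(q, s)`, with `s` comparable to `δ*`, into the
slit plane, and the Riemann map `slitCayley` yields a holomorphic `f` bounded by `1` with `f q = 0`
and `‖df_q X‖ = ‖X_q‖ / (8‖e‖)`.

This local `f` becomes global in `exists_mem_sibonyClass`: with `D ⊆ B(q, R)`, the function
`(s/5R)²|f|² + ‖z - q‖²/(5R)²` is glued by a maximum to `(‖z - q‖/R)^(2+ε)`. The second function
wins for `‖z - q‖ ≥ s/2`, the first near `q`. The factor `s` in front of `|f|` is what produces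
`δ*`.

Log-plurisubharmonicity of the glued function rests on its being touched from below, at every point,
by a power of the norm of a holomorphic map. This gives a maximum principle, stable under
multiplication by `|exp g|`, and thence the sub-mean value inequality. -/

/-! ### Log-plurisubharmonicity from holomorphic supports -/

/-- At `z`, the function `v` is supported from below by a positive power of the norm of a
holomorphic map. -/
def HasHolomorphicSupport {V : Type*} [NormedAddCommGroup V] [NormedSpace ℂ V]
    (E : Type*) [NormedAddCommGroup E] [NormedSpace ℂ E] (v : V → ℝ) (z : V) : Prop :=
  ∃ (α : ℝ) (F : V → E), 0 < α ∧ (∀ᶠ w in 𝓝 z, DifferentiableAt ℂ F w) ∧ v z = ‖F z‖ ^ α ∧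
    ∀ᶠ w in 𝓝 z, ‖F w‖ ^ α ≤ v w

namespace HasHolomorphicSupport

variable {V : Type*} [NormedAddCommGroup V] [NormedSpace ℂ V]
  {E : Type*} [NormedAddCommGroup E] [NormedSpace ℂ E]

theorem comp {V' : Type*} [NormedAddCommGroup V'] [NormedSpace ℂ V'] {v : V → ℝ} {g : V' → V}
    {z : V'} (hv : HasHolomorphicSupport E v (g z)) (hg : Differentiable ℂ g) :
    HasHolomorphicSupport E (v ∘ g) z := by
  obtain ⟨α, F, hα, hF, hz, hle⟩ := hv
  have hc : Tendsto g (𝓝 z) (𝓝 (g z)) := hg.continuous.continuousAt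
  refine ⟨α, F ∘ g, hα, ?_, hz, hc.eventually hle⟩
  filter_upwards [hc.eventually hF] with w hw
  exact hw.comp w (hg w)

theorem mul_exp_re {v : V → ℝ} {g : V → ℂ} {z : V} (hv : HasHolomorphicSupport E v z)
    (hg : Differentiable ℂ g) :
    HasHolomorphicSupport E (fun w => v w * Real.exp (g w).re) z := by
  obtain ⟨α, F, hα, hF, hz, hle⟩ := hv
  have key (w : V) :
      ‖Complex.exp (g w * (α : ℂ)⁻¹) • F w‖ ^ α = ‖F w‖ ^ α * Real.exp (g w).re := by
    rw [norm_smul, Real.mul_rpow (norm_nonneg _) (norm_nonneg _), Complex.norm_exp,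
      ← Real.exp_mul, mul_comm, ← Complex.ofReal_inv, Complex.re_mul_ofReal,
      inv_mul_cancel_right₀ hα.ne']
  -- Dividing `g` by `α` compensates for the exponent `α` on the norm.
  refine ⟨α, fun w => Complex.exp (g w * (α : ℂ)⁻¹) • F w, hα, ?_, ?_, ?_⟩
  · filter_upwards [hF] with w hw
    exact ((hg w).mul_const (α : ℂ)⁻¹).cexp.smul hw
  · simp only [key, hz]
  · filter_upwards [hle] with w hw
    rw [key]
    gcongr

/-- The support `‖F‖ ^ α` inherits the local maximum, so `‖F‖` is locally constant by the maximum
modulus principle, and `v` is squeezed between it and `v z`. -/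
theorem eventually_eq_of_isLocalMax {v : V → ℝ} {z : V} (hv : HasHolomorphicSupport E v z)
    (hmax : IsLocalMax v z) : ∀ᶠ w in 𝓝 z, v w = v z := by
  obtain ⟨α, F, hα, hF, hz, hle⟩ := hv
  have hFmax : IsLocalMax (norm ∘ F) z := by
    filter_upwards [hle, hmax] with w h1 h2
    have h3 := h1.trans (h2.trans hz.le)
    exact (Real.rpow_le_rpow_iff (norm_nonneg _) (norm_nonneg _) hα).1 h3
  filter_upwards [hle, hmax, Complex.norm_eventually_eq_of_isLocalMax hF hFmax] with w h1 h2 h3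
  refine le_antisymm h2 ?_
  rw [hz, ← h3]
  exact h1

end HasHolomorphicSupport

/-- Among the maximum points of `W`, take one of largest modulus. If it were interior, `W` would be
constant around it, so the modulus of the identity would have a local maximum there, which is
impossible. -/
theorem exists_sphere_ge_of_hasHolomorphicSupport {E : Type*} [NormedAddCommGroup E]
    [NormedSpace ℂ E] {W : ℂ → ℝ} (hW : ContinuousOn W (Metric.closedBall 0 1))
    (hs : ∀ z ∈ Metric.ball (0 : ℂ) 1, HasHolomorphicSupport E W z) :
    ∃ z : ℂ, ‖z‖ = 1 ∧ W 0 ≤ W z := by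
  have hK : IsCompact (Metric.closedBall (0 : ℂ) 1) := isCompact_closedBall _ _
  obtain ⟨z₀, hz₀, hmax⟩ := hK.exists_isMaxOn ⟨0, by simp⟩ hW
  have hS : IsCompact (Metric.closedBall (0 : ℂ) 1 ∩ W ⁻¹' {W z₀}) :=
    hK.of_isClosed_subset (hW.preimage_isClosed_of_isClosed Metric.isClosed_closedBall
      isClosed_singleton) inter_subset_left
  obtain ⟨z, ⟨hz, hWz⟩, hzmax⟩ := hS.exists_isMaxOn ⟨z₀, hz₀, rfl⟩ continuous_norm.continuousOn
  simp only [mem_preimage, mem_singleton_iff] at hWz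
  refine ⟨z, ?_, ?_⟩
  · by_contra hne
    have hzb : z ∈ Metric.ball (0 : ℂ) 1 := by
      simp only [Metric.mem_closedBall, dist_zero_right, Metric.mem_ball] at hz ⊢
      exact lt_of_le_of_ne hz hne
    have hnhds := Metric.isOpen_ball.mem_nhds hzb
    have hloc : IsLocalMax W z := by
      filter_upwards [hnhds] with w hw
      rw [hWz]
      exact hmax (Metric.ball_subset_closedBall hw)
    have hn : IsLocalMax (norm ∘ (id : ℂ → ℂ)) z := by
      filter_upwards [hnhds, (hs z hzb).eventually_eq_of_isLocalMax hloc] with w hw hWw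
      exact hzmax ⟨Metric.ball_subset_closedBall hw, hWw.trans hWz⟩
    have h := Complex.eventually_eq_of_isLocalMax_norm
      (Eventually.of_forall fun w => differentiableAt_id) hn
    have h2 : ∀ᶠ y in 𝓝[≠] z, False := by
      filter_upwards [h.filter_mono nhdsWithin_le_nhds, self_mem_nhdsWithin] with y h1 h2
      exact h2 h1
    exact NeBot.ne inferInstance (by simpa using h2 : 𝓝[≠] z = ⊥)
  · rw [hWz]
    exact hmax (by simp)

/-- Trigonometric polynomials are dense, and on the circle each is `P + conj Q` with polynomials
`P`, `Q`; its real part is that of `P + Q`. -/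
theorem exists_polynomial_re_near_on_circle {φ : ℂ → ℝ} (hφ : ContinuousOn φ (Metric.sphere 0 1))
    {ε : ℝ} (hε : 0 < ε) :
    ∃ P : Polynomial ℂ, ∀ z : ℂ, ‖z‖ = 1 → |(P.eval z).re - φ z| < ε := by
  have : Fact ((0 : ℝ) < 1) := ⟨one_pos⟩
  let T : AddCircle (1 : ℝ) → ℂ := fun x => (AddCircle.toCircle x : ℂ)
  have hT : Continuous T := by fun_prop
  have hT1 (x) : ‖T x‖ = 1 := Circle.norm_coe _
  have hφT : Continuous fun x => (φ (T x) : ℂ) := by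
    refine Complex.continuous_ofReal.comp (hφ.comp_continuous hT fun x => ?_)
    simp [hT1]
  let Φ : C(AddCircle (1 : ℝ), ℂ) := ⟨_, hφT⟩
  have hmem : Φ ∈ (Submodule.span ℂ (Set.range (fourier (T := (1 : ℝ))))).topologicalClosure := by
    rw [span_fourier_closure_eq_top]; trivial
  obtain ⟨G, hG, hdist⟩ := Metric.mem_closure_iff.1 hmem ε hε
  have hrep : ∃ P Q : Polynomial ℂ, ∀ x, G x = P.eval (T x) + star (Q.eval (T x)) := by
    refine Submodule.span_induction (p := fun G _ => ∃ P Q : Polynomial ℂ, ∀ x,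
      G x = P.eval (T x) + star (Q.eval (T x))) ?_ ?_ ?_ ?_ hG
    · rintro _ ⟨n, rfl⟩
      obtain ⟨m, rfl | rfl⟩ := n.eq_nat_or_neg
      · refine ⟨Polynomial.X ^ m, 0, fun x => ?_⟩
        simp [T, AddCircle.toCircle_nsmul]
      · refine ⟨0, Polynomial.X ^ m, fun x => ?_⟩
        simp [T, AddCircle.toCircle_nsmul, AddCircle.toCircle_neg, ← Circle.coe_inv_eq_conj]
    · exact ⟨0, 0, fun x => by simp⟩
    · rintro G₁ G₂ - - ⟨P₁, Q₁, h₁⟩ ⟨P₂, Q₂, h₂⟩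
      refine ⟨P₁ + P₂, Q₁ + Q₂, fun x => ?_⟩
      simp only [ContinuousMap.add_apply, h₁, h₂, Polynomial.eval_add, star_add]
      ring
    · rintro c G₁ - ⟨P, Q, h⟩
      refine ⟨Polynomial.C c * P, Polynomial.C (star c) * Q, fun x => ?_⟩
      simp only [ContinuousMap.smul_apply, h, Polynomial.eval_mul, Polynomial.eval_C, star_mul',
        star_star, smul_eq_mul]
      ring
  obtain ⟨P, Q, hPQ⟩ := hrep
  refine ⟨P + Q, fun z hz => ?_⟩
  obtain ⟨x, hx⟩ : ∃ x, T x = z := by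
    obtain ⟨x, hx⟩ := (AddCircle.homeomorphCircle (one_ne_zero (α := ℝ))).surjective
      ⟨z, by simpa [Submonoid.unitSphere] using hz⟩
    exact ⟨x, by simpa [AddCircle.homeomorphCircle_apply] using congrArg Subtype.val hx⟩
  have h1 : ‖Φ x - G x‖ < ε := by
    rw [← dist_eq_norm]; exact (ContinuousMap.dist_apply_le_dist x).trans_lt hdist
  have h2 : ((P + Q).eval z).re = (G x).re := by
    rw [hPQ, hx]; simp
  have h3 := (Complex.abs_re_le_norm (Φ x - G x)).trans_lt h1
  have h4 : (Φ x).re = φ z := by simp [Φ, hx]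
  rwa [Complex.sub_re, h4, ← h2, abs_sub_comm] at h3

/-- With `Re P` close to `log (max W η)` on the circle, the maximum principle for `W * |exp (-P)|`
bounds `log (W 0)` by about `Re P(0)`, which is the circle mean of `Re P`. The cutoff `η` keeps the
logarithm continuous at zeros of `W`. -/
theorem log_le_circleAverage_log_max {E : Type*} [NormedAddCommGroup E]
    [NormedSpace ℂ E] {W : ℂ → ℝ} (hW : ContinuousOn W (Metric.closedBall 0 1))
    (hs : ∀ z ∈ Metric.ball (0 : ℂ) 1, HasHolomorphicSupport E W z) (h0 : 0 < W 0)
    {η : ℝ} (hη : 0 < η) :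
    Real.log (W 0) ≤ Real.circleAverage (fun z => Real.log (max (W z) η)) 0 1 := by
  have hpos (z : ℂ) : 0 < max (W z) η := lt_max_of_lt_right hη
  have hφ : ContinuousOn (fun z => Real.log (max (W z) η)) (Metric.sphere 0 1) := by
    refine ContinuousOn.log ?_ fun z _ => (hpos z).ne'
    exact (hW.mono Metric.sphere_subset_closedBall).sup continuousOn_const
  refine le_of_forall_pos_le_add fun ε hε => ?_
  obtain ⟨P, hP⟩ := exists_polynomial_re_near_on_circle hφ (half_pos hε)
  have hPd : Differentiable ℂ fun z => -P.eval z := P.differentiable.neg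
  obtain ⟨z, hz, hle⟩ := exists_sphere_ge_of_hasHolomorphicSupport (E := E)
    (W := fun z => W z * Real.exp (-P.eval z).re)
    (hW.mul (Continuous.continuousOn (by have := hPd.continuous; fun_prop)))
    fun z hz => (hs z hz).mul_exp_re hPd
  have hPc : CircleIntegrable (fun z => P.eval z) 0 1 :=
    (P.continuous.continuousOn).circleIntegrable zero_le_one
  have hmean : Real.circleAverage (fun z => (P.eval z).re) 0 1 = (P.eval 0).re := by
    have h1 := ContinuousLinearMap.circleAverage_comp_comm Complex.reCLM hPc
    have h2 := DiffContOnCl.circleAverage (c := 0) (R := 1) (P.differentiable.diffContOnCl)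
    rw [h2] at h1
    exact h1
  have hb := abs_lt.1 (hP z hz)
  have h1 : W z * Real.exp (-P.eval z).re ≤ Real.exp (ε / 2) := by
    have : W z ≤ Real.exp ((P.eval z).re + ε / 2) := by
      calc W z ≤ max (W z) η := le_max_left _ _
        _ = Real.exp (Real.log (max (W z) η)) := (Real.exp_log (hpos z)).symm
        _ ≤ _ := Real.exp_le_exp.2 (by linarith)
    calc _ ≤ Real.exp ((P.eval z).re + ε / 2) * Real.exp (-P.eval z).re := by gcongr
      _ = _ := by rw [← Real.exp_add]; congr 1; simp
  have h2 : Real.log (W 0) ≤ (P.eval 0).re + ε / 2 := by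
    have h3 := Real.log_le_log (by positivity) (hle.trans h1)
    rw [Real.log_mul h0.ne' (Real.exp_pos _).ne', Real.log_exp, Real.log_exp] at h3
    simp only [Complex.neg_re] at h3
    linarith
  have h4 : Real.circleAverage (fun z => (P.eval z).re) 0 1 ≤
      Real.circleAverage (fun z => Real.log (max (W z) η) + ε / 2) 0 1 := by
    refine Real.circleAverage_mono ?_ ?_ ?_
    · exact (Complex.continuous_re.comp P.continuous).continuousOn.circleIntegrable zero_le_one
    · exact (hφ.add continuousOn_const).circleIntegrable zero_le_one
    · intro w hw
      have := abs_lt.1 (hP w (by simpa using hw))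
      linarith
  have h5 : Real.circleAverage (fun z => Real.log (max (W z) η) + ε / 2) 0 1 =
      Real.circleAverage (fun z => Real.log (max (W z) η)) 0 1 + ε / 2 := by
    rw [Real.circleAverage_fun_add (hφ.circleIntegrable zero_le_one)
      (continuousOn_const.circleIntegrable zero_le_one), Real.circleAverage_const]
  linarith

theorem toENNReal_neg_log_ofReal_eq_iSup (x : ℝ) :
    (-ENNReal.log (ENNReal.ofReal x)).toENNReal =
      ⨆ N : ℕ, ENNReal.ofReal (-Real.log (max x (Real.exp (-N)))) := by
  rcases le_or_gt x 0 with hx | hx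
  · rw [ENNReal.ofReal_of_nonpos hx, ENNReal.log_zero, EReal.neg_bot, EReal.toENNReal_top]
    have (N : ℕ) : -Real.log (max x (Real.exp (-N))) = N := by
      rw [max_eq_right (hx.trans (Real.exp_pos _).le), Real.log_exp, neg_neg]
    simp only [this, ENNReal.ofReal_natCast, ENNReal.iSup_natCast]
  · rw [ENNReal.log_ofReal_of_pos hx, ← EReal.coe_neg, EReal.real_coe_toENNReal]
    refine le_antisymm ?_ (iSup_le fun N => ?_)
    · obtain ⟨N, hN⟩ := exists_nat_ge (-Real.log x)
      refine le_iSup_of_le N (le_of_eq ?_)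
      rw [max_eq_left]
      rw [← Real.exp_log hx]
      exact Real.exp_le_exp.2 (by linarith)
    · exact ENNReal.ofReal_le_ofReal (neg_le_neg (Real.log_le_log hx (le_max_left _ _)))

/-- Since `W < 1`, the logarithm has no positive part; monotone convergence along the cutoffs `exp
(-N)` removes `η`. -/
theorem log_le_unitCircleMean {E : Type*} [NormedAddCommGroup E]
    [NormedSpace ℂ E] {W : ℂ → ℝ} (hW : ContinuousOn W (Metric.closedBall 0 1))
    (hW1 : ∀ z ∈ Metric.closedBall (0 : ℂ) 1, W z < 1)
    (hs : ∀ z ∈ Metric.ball (0 : ℂ) 1, HasHolomorphicSupport E W z) :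
    ENNReal.log (ENNReal.ofReal (W 0)) ≤
      unitCircleMean (fun l => ENNReal.log (ENNReal.ofReal (W l))) := by
  rcases le_or_gt (W 0) 0 with h0 | h0
  · rw [ENNReal.ofReal_of_nonpos h0, ENNReal.log_zero]
    exact bot_le
  let c : ℝ → ℂ := fun t => Complex.exp (t * Complex.I)
  have hc : Continuous c := by fun_prop
  have hc1 (t : ℝ) : c t ∈ Metric.closedBall (0 : ℂ) 1 := by
    simp [c, Complex.norm_exp_ofReal_mul_I]
  have hle0 (z : ℂ) (hz : z ∈ Metric.closedBall (0 : ℂ) 1) :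
      ENNReal.log (ENNReal.ofReal (W z)) ≤ 0 := by
    rw [ENNReal.log_le_zero_iff]
    simpa using (hW1 z hz).le
  have hpos : ∫⁻ t in Ioc (0 : ℝ) (2 * Real.pi),
      (ENNReal.log (ENNReal.ofReal (W (c t)))).toENNReal = 0 := by
    simp only [EReal.toENNReal_of_nonpos (hle0 _ (hc1 _)), lintegral_zero]
  unfold unitCircleMean
  change _ ≤ ((_ * ∫⁻ t in Ioc (0 : ℝ) (2 * Real.pi),
      (ENNReal.log (ENNReal.ofReal (W (c t)))).toENNReal : ℝ≥0∞) : EReal)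
    - ((_ * ∫⁻ t in Ioc (0 : ℝ) (2 * Real.pi),
      (-ENNReal.log (ENNReal.ofReal (W (c t)))).toENNReal : ℝ≥0∞) : EReal)
  rw [hpos, mul_zero, EReal.coe_ennreal_zero, zero_sub, EReal.le_neg]
  rw [← EReal.coe_toENNReal (x := -ENNReal.log (ENNReal.ofReal (W 0)))
    (by simpa using hle0 0 (by simp)), EReal.coe_ennreal_le_coe_ennreal_iff,
    ENNReal.log_ofReal_of_pos h0, ← EReal.coe_neg, EReal.real_coe_toENNReal]
  have hcont : Continuous fun t => W (c t) := hW.comp_continuous hc hc1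
  have hlog (N : ℕ) : Continuous fun t => -Real.log (max (W (c t)) (Real.exp (-N))) :=
    (Continuous.log (hcont.max continuous_const)
      fun t => (lt_max_of_lt_right (Real.exp_pos _)).ne').neg
  simp only [toENNReal_neg_log_ofReal_eq_iSup]
  rw [lintegral_iSup (fun N => (hlog N).measurable.ennreal_ofReal), ENNReal.mul_iSup]
  swap
  · intro N M hNM t
    refine ENNReal.ofReal_le_ofReal (neg_le_neg (Real.log_le_log
      (lt_max_of_lt_right (Real.exp_pos _)) (max_le_max le_rfl (Real.exp_le_exp.2 ?_))))
    simpa using hNM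
  refine iSup_le fun N => ?_
  have hnn (t : ℝ) : 0 ≤ -Real.log (max (W (c t)) (Real.exp (-N))) := by
    refine neg_nonneg.2 (Real.log_nonpos (le_max_of_le_right (Real.exp_pos _).le) ?_)
    exact max_le (hW1 _ (hc1 t)).le (Real.exp_le_one_iff.2 (by simp))
  rw [← ofReal_integral_eq_lintegral_ofReal
    ((hlog N).integrableOn_Icc.mono_set Ioc_subset_Icc_self) (ae_of_all _ hnn),
    ← ENNReal.ofReal_mul (by positivity)]
  refine ENNReal.ofReal_le_ofReal ?_
  have key := log_le_circleAverage_log_max hW hs h0 (Real.exp_pos (-N))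
  rw [Real.circleAverage_def, intervalIntegral.integral_of_le (by positivity)] at key
  have hcm (t : ℝ) : circleMap 0 1 t = c t := by simp [circleMap, c]
  simp only [hcm, smul_eq_mul] at key
  rw [integral_neg]
  linarith

theorem isPlurisubharmonicOn_log_of_hasHolomorphicSupport {n : ℕ} {E : Type*}
    [NormedAddCommGroup E] [NormedSpace ℂ E] {D : Set (CSpace n)} {v : CSpace n → ℝ}
    (hv : ContinuousOn v D) (hv1 : ∀ z ∈ D, v z < 1)
    (hs : ∀ z ∈ D, HasHolomorphicSupport E v z) :
    IsPlurisubharmonicOn (fun w => ENNReal.log (ENNReal.ofReal (v w))) D := by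
  refine ⟨fun z _ => ENNReal.log_lt_top_iff.2 ENNReal.ofReal_lt_top, ?_, fun a b hab => ?_⟩
  · exact (ENNReal.continuous_log.comp_continuousOn
      (ENNReal.continuous_ofReal.comp_continuousOn hv)).upperSemicontinuousOn
  · have hd : Differentiable ℂ fun l : ℂ => a + l • b := by fun_prop
    have hm (l : ℂ) (hl : l ∈ Metric.closedBall (0 : ℂ) 1) : a + l • b ∈ D :=
      hab l (by simpa using hl)
    have := log_le_unitCircleMean (E := E) (W := v ∘ fun l : ℂ => a + l • b)
      (hv.comp hd.continuous.continuousOn hm) (fun l hl => hv1 _ (hm l hl))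
      fun l hl => HasHolomorphicSupport.comp (g := fun l : ℂ => a + l • b)
        (hs _ (hm l (Metric.ball_subset_closedBall hl))) hd
    simpa only [Function.comp_apply, zero_smul, add_zero] using this

/-! ### The Levi form of a squared norm -/

theorem leviForm_congr {n : ℕ} {v w : CSpace n → ℝ} {q : CSpace n} (h : v =ᶠ[𝓝 q] w)
    (X : CSpace n) : leviForm v q X = leviForm w q X := by
  unfold leviForm
  rw [h.fderiv.fderiv_eq]

/-- The term containing the second derivative of `F` is paired with `F q = 0`. What remains is `2‖dF
Y‖²` for `Y = X` and `Y = iX`, equal by complex linearity. -/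
theorem leviForm_norm_sq {n : ℕ} {E : Type*} [NormedAddCommGroup E] [InnerProductSpace ℂ E]
    {F : CSpace n → E} {q : CSpace n} (hF : ContDiffAt ℂ 2 F q) (hq : F q = 0) (X : CSpace n) :
    leviForm (fun z => ‖F z‖ ^ 2) q X = ‖fderiv ℂ F q X‖ ^ 2 := by
  let : InnerProductSpace ℝ E := InnerProductSpace.complexToReal
  have hR : ContDiffAt ℝ 2 F q := hF.restrict_scalars ℝ
  have hev : ∀ᶠ z in 𝓝 q, DifferentiableAt ℝ F z := by
    filter_upwards [hR.eventually (by simp)] with z hz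
    exact hz.differentiableAt (by simp)
  have h1 : fderiv ℝ (fun z => ‖F z‖ ^ 2) =ᶠ[𝓝 q]
      fun z => (2 : ℕ) • ((innerSL ℝ (F z)) ∘L fderiv ℝ F z) := by
    filter_upwards [hev] with z hz
    exact hz.hasFDerivAt.norm_sq.fderiv
  have h2 : HasFDerivAt (fderiv ℝ F) (fderiv ℝ (fderiv ℝ F) q) q :=
    ((hR.fderiv_right (m := 1) le_rfl).differentiableAt one_ne_zero).hasFDerivAt
  have h3 : HasFDerivAt F (fderiv ℝ F q) q := hev.self_of_nhds.hasFDerivAt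
  have h4 : HasFDerivAt (fun z => innerSL ℝ (F z)) ((innerSL ℝ : E →L[ℝ] _) ∘L fderiv ℝ F q) q :=
    (innerSL ℝ : E →L[ℝ] _).hasFDerivAt.comp q h3
  have h5 := ((h4.clm_comp h2).const_smul (2 : ℕ))
  have h6 (Y : CSpace n) : fderiv ℝ (fderiv ℝ fun z => ‖F z‖ ^ 2) q Y Y
      = 2 * ‖fderiv ℝ F q Y‖ ^ 2 := by
    rw [h1.fderiv_eq]
    refine (congrArg (fun T => T Y Y) h5.fderiv).trans ?_
    simp [hq]
    exact real_inner_self_eq_norm_sq (fderiv ℝ F q Y)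
  have h7 : fderiv ℝ F q = (fderiv ℂ F q).restrictScalars ℝ :=
    (hF.differentiableAt (by simp)).fderiv_restrictScalars ℝ
  unfold leviForm
  rw [h6, h6, h7]
  simp only [ContinuousLinearMap.coe_restrictScalars', map_smul, norm_smul, Complex.norm_I,
    one_mul]
  ring

theorem contDiffAt_norm_sq_of_complex {n : ℕ} {E : Type*} [NormedAddCommGroup E]
    [InnerProductSpace ℂ E] {F : CSpace n → E} {q : CSpace n} (hF : ContDiffAt ℂ 2 F q) :
    ContDiffAt ℝ 2 (fun z => ‖F z‖ ^ 2) q :=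
  let : InnerProductSpace ℝ E := InnerProductSpace.complexToReal
  (hF.restrict_scalars ℝ).norm_sq ℝ

/-! ### Gluing a local bounded holomorphic function into a global competitor -/

theorem norm_sq_toLp_mul_smul {E : Type*} [NormedAddCommGroup E] [NormedSpace ℂ E]
    (a b : ℝ) (w : ℂ) (x : E) :
    ‖WithLp.toLp 2 ((a : ℂ) * w, (b : ℂ) • x)‖ ^ 2 = (a * ‖w‖) ^ 2 + (b * ‖x‖) ^ 2 := by
  rw [WithLp.prod_norm_sq_eq_of_L2, WithLp.toLp_fst, WithLp.toLp_snd, norm_mul, norm_smul,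
    Complex.norm_real, Complex.norm_real, Real.norm_eq_abs, Real.norm_eq_abs, mul_pow, mul_pow,
    mul_pow, mul_pow, sq_abs, sq_abs]

theorem exists_pos_rpow_eq_fifth {a : ℝ} (h0 : 0 < a) (h1 : a < 1) :
    ∃ ε : ℝ, 0 < ε ∧ a ^ ε = 1 / 5 := by
  have hl : Real.log a < 0 := Real.log_neg h0 h1
  have h5 : 0 < Real.log 5 := Real.log_pos (by norm_num)
  refine ⟨Real.log 5 / -Real.log a, div_pos h5 (neg_pos.2 hl), ?_⟩
  rw [Real.rpow_def_of_pos h0, ← mul_div_assoc, mul_div_right_comm, div_neg, div_self hl.ne,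
    neg_one_mul, Real.exp_neg, Real.exp_log (by norm_num), one_div]

theorem exists_mem_sibonyClass {n : ℕ} {D : Set (CSpace n)} (hD : IsOpen D) {q : CSpace n}
    {R s : ℝ} (hR : ∀ z ∈ D, ‖z - q‖ < R) (hs : 0 < s) (hsR : s ≤ R)
    {f : CSpace n → ℂ} (hf : DifferentiableOn ℂ f (D ∩ Metric.ball q s))
    (hf1 : ∀ z ∈ D ∩ Metric.ball q s, ‖f z‖ ≤ 1) (hfq : f q = 0) (hfc : ContDiffAt ℂ 2 f q) :
    ∃ v ∈ sibonyClass D q, ∀ X : CSpace n,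
      leviForm v q X = (s / (5 * R) * ‖fderiv ℂ f q X‖) ^ 2 + (‖X‖ / (5 * R)) ^ 2 := by
  have hR0 : 0 < R := hs.trans_le hsR
  -- This `ε` makes `t ^ ε ≥ 1/5` for `‖z - q‖ ≥ s/2`, where `‖F₁‖² ≤ (4 + 1) t² / 25 = t² / 5`.
  obtain ⟨ε, hε, hsε⟩ := exists_pos_rpow_eq_fifth (a := s / (2 * R)) (by positivity)
    (by rw [div_lt_one (by positivity)]; linarith)
  let F₁ : CSpace n → WithLp 2 (ℂ × CSpace n) := fun z =>
    WithLp.toLp 2 (((s / (5 * R) : ℝ) : ℂ) * f z, (((5 * R)⁻¹ : ℝ) : ℂ) • (z - q))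
  -- The zero component gives both supports the same target space.
  let F₂ : CSpace n → WithLp 2 (ℂ × CSpace n) := fun z =>
    WithLp.toLp 2 (0, ((R⁻¹ : ℝ) : ℂ) • (z - q))
  let t : CSpace n → ℝ := fun z => ‖z - q‖ / R
  have ht0 (z) : 0 ≤ t z := by positivity
  have htq : t q = 0 := by simp [t]
  have ht1 (z) (hz : z ∈ D) : t z < 1 := (div_lt_one hR0).2 (hR z hz)
  have htc : Continuous t := by fun_prop
  have hF₁ (z) : ‖F₁ z‖ ^ 2 = (s / (5 * R) * ‖f z‖) ^ 2 + (t z / 5) ^ 2 := by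
    rw [norm_sq_toLp_mul_smul]
    simp only [t]
    congr 2
    field_simp
  have hF₂ (z) : ‖F₂ z‖ = t z := by
    rw [← sq_eq_sq₀ (norm_nonneg _) (ht0 z), WithLp.prod_norm_sq_eq_of_L2, WithLp.toLp_fst,
      WithLp.toLp_snd, norm_smul, Complex.norm_real, Real.norm_eq_abs, norm_zero,
      abs_of_pos (by positivity)]
    ring
  have hadd (z) : t z ^ (2 + ε) = t z ^ 2 * t z ^ ε := by
    rw [Real.rpow_add_of_nonneg (ht0 z) zero_le_two hε.le, Real.rpow_two]
  have hopen : IsOpen (D ∩ Metric.ball q s) := hD.inter Metric.isOpen_ball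
  have hF₁d {z} (hz : DifferentiableAt ℂ f z) : DifferentiableAt ℂ F₁ z := by
    refine (WithLp.prodContinuousLinearEquiv 2 ℂ ℂ (CSpace n)).symm.differentiableAt.comp z ?_
    exact (hz.const_mul _).prodMk ((differentiableAt_id.sub_const q).fun_const_smul _)
  have hF₂d (z) : DifferentiableAt ℂ F₂ z := by
    refine (WithLp.prodContinuousLinearEquiv 2 ℂ ℂ (CSpace n)).symm.differentiableAt.comp z ?_
    exact (differentiableAt_const _).prodMk ((differentiableAt_id.sub_const q).fun_const_smul _)
  have hfd {z} (hz : z ∈ D ∩ Metric.ball q s) : ∀ᶠ w in 𝓝 z, DifferentiableAt ℂ f w := by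
    filter_upwards [hopen.mem_nhds hz] with w hw
    exact hf.differentiableAt (hopen.mem_nhds hw)
  have houter (z) (hz : z ∈ D ∩ Metric.ball q s) (hz2 : s / 2 ≤ ‖z - q‖) :
      ‖F₁ z‖ ^ 2 ≤ t z ^ (2 + ε) := by
    have h1 : s / (2 * R) ≤ t z := by
      rw [← div_div]; exact div_le_div_of_nonneg_right hz2 hR0.le
    have h2 : 1 / 5 ≤ t z ^ ε := by
      rw [← hsε]; exact Real.rpow_le_rpow (by positivity) h1 hε.le
    have h3 : s / (5 * R) * ‖f z‖ ≤ 2 * t z / 5 := by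
      calc s / (5 * R) * ‖f z‖ ≤ s / (5 * R) * 1 := by gcongr; exact hf1 z hz
        _ = 2 * (s / (2 * R)) / 5 := by field_simp
        _ ≤ _ := by gcongr
    rw [hF₁, hadd]
    calc _ ≤ (2 * t z / 5) ^ 2 + (t z / 5) ^ 2 := by gcongr
      _ = t z ^ 2 * (1 / 5) := by ring
      _ ≤ _ := by gcongr
  -- The exponent exceeds `2`, so near `q` the term `(t / 5)²` of `‖F₁‖²` alone dominates.
  have hinner : ∀ᶠ z in 𝓝 q, t z ^ (2 + ε) ≤ ‖F₁ z‖ ^ 2 := by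
    have h1 : Tendsto (fun z => t z ^ ε) (𝓝 q) (𝓝 0) := by
      have := (htc.rpow_const fun z => Or.inr hε.le).tendsto q
      simpa [htq, Real.zero_rpow hε.ne'] using this
    filter_upwards [h1.eventually (gt_mem_nhds (show (0 : ℝ) < 1 / 25 by norm_num))] with z hz
    rw [hF₁, hadd]
    calc _ ≤ t z ^ 2 * (1 / 25) := by gcongr
      _ = 0 + (t z / 5) ^ 2 := by ring
      _ ≤ _ := by gcongr; positivity
  classical
  let v : CSpace n → ℝ := fun z =>
    if z ∈ Metric.ball q s then max (‖F₁ z‖ ^ 2) (t z ^ (2 + ε)) else t z ^ (2 + ε)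
  have hv_in {z} (hz : z ∈ Metric.ball q s) : v z = max (‖F₁ z‖ ^ 2) (t z ^ (2 + ε)) := if_pos hz
  have hv_ge (z) : t z ^ (2 + ε) ≤ v z := by
    by_cases hz : z ∈ Metric.ball q s
    · rw [hv_in hz]; exact le_max_right _ _
    · exact (if_neg hz).ge
  have hv_out {z} (hz : z ∈ D) (hz2 : s / 2 ≤ ‖z - q‖) : v z = t z ^ (2 + ε) := by
    by_cases hzb : z ∈ Metric.ball q s
    · rw [hv_in hzb]; exact max_eq_right (houter z ⟨hz, hzb⟩ hz2)
    · exact if_neg hzb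
  have hrc : Continuous fun z => t z ^ (2 + ε) :=
    htc.rpow_const fun z => Or.inr (by positivity)
  have hball : Metric.ball q s ∈ 𝓝 q := Metric.ball_mem_nhds q hs
  have hvq : v =ᶠ[𝓝 q] fun z => ‖F₁ z‖ ^ 2 := by
    filter_upwards [hinner, hball] with z hz hzb
    rw [hv_in hzb]; exact max_eq_left hz
  have hcont : ContinuousOn v D := by
    intro z hz
    refine ContinuousAt.continuousWithinAt ?_
    by_cases hzb : z ∈ Metric.ball q s
    · have h1 : ContinuousAt (fun z => max (‖F₁ z‖ ^ 2) (t z ^ (2 + ε))) z :=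
        ((hF₁d (hfd ⟨hz, hzb⟩).self_of_nhds).continuousAt.norm.pow 2).max hrc.continuousAt
      refine h1.congr ?_
      filter_upwards [Metric.isOpen_ball.mem_nhds hzb] with w hw
      exact (hv_in hw).symm
    · refine hrc.continuousAt.congr ?_
      have h2 : s / 2 < ‖z - q‖ := by
        rw [Metric.mem_ball, dist_eq_norm, not_lt] at hzb; linarith
      have h3 : ContinuousAt (fun z => ‖z - q‖) z := by fun_prop
      filter_upwards [hD.mem_nhds hz, h3.eventually (lt_mem_nhds h2)] with w hw hw2
      exact (hv_out hw hw2.le).symm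
  have hlt (z) (hz : z ∈ D) : v z < 1 := by
    have h2 : t z ^ (2 + ε) < 1 := Real.rpow_lt_one (ht0 z) (ht1 z hz) (by positivity)
    by_cases hzb : z ∈ Metric.ball q s
    · rw [hv_in hzb]
      refine max_lt ?_ h2
      have h3 : s / (5 * R) * ‖f z‖ ≤ 1 / 5 := by
        calc s / (5 * R) * ‖f z‖ ≤ R / (5 * R) * 1 := by gcongr; exact hf1 z ⟨hz, hzb⟩
          _ = 1 / 5 := by field_simp
      rw [hF₁]
      calc _ ≤ (1 / 5 : ℝ) ^ 2 + (1 / 5) ^ 2 := by gcongr; exact (ht1 z hz).le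
        _ < 1 := by norm_num
    · exact (if_neg hzb).trans_lt h2
  have hsupp (z) (hz : z ∈ D) : HasHolomorphicSupport (WithLp 2 (ℂ × CSpace n)) v z := by
    -- `F₂` supports `v` wherever the power of `t` is attained, as `v` is nowhere smaller; elsewhere
    -- `z` lies in the ball and `F₁` does.
    by_cases h : v z = t z ^ (2 + ε)
    · refine ⟨2 + ε, F₂, by positivity, Eventually.of_forall hF₂d, by rw [hF₂, h],
        Eventually.of_forall fun w => ?_⟩
      rw [hF₂]; exact hv_ge w
    · have hzb : z ∈ Metric.ball q s := by
        by_contra hzb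
        exact h (if_neg hzb)
      refine ⟨2, F₁, zero_lt_two, (hfd ⟨hz, hzb⟩).mono fun w => hF₁d, ?_, ?_⟩
      · rw [Real.rpow_two]
        rcases max_choice (‖F₁ z‖ ^ 2) (t z ^ (2 + ε)) with h' | h'
        · rw [hv_in hzb, h']
        · exact absurd ((hv_in hzb).trans h') h
      · filter_upwards [Metric.isOpen_ball.mem_nhds hzb] with w hw
        rw [Real.rpow_two, hv_in hw]
        exact le_max_left _ _
  have hF₁q : F₁ q = 0 := by
    have : ‖F₁ q‖ ^ 2 = 0 := by rw [hF₁, hfq, htq]; simp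
    simpa using this
  have hF₁c : ContDiffAt ℂ 2 F₁ q := by
    refine (WithLp.prodContinuousLinearEquiv 2 ℂ ℂ (CSpace n)).symm.contDiff.contDiffAt.comp q ?_
    exact (contDiffAt_const.mul hfc).prodMk
      ((contDiffAt_id.sub contDiffAt_const).const_smul _)
  have hF₁' (X : CSpace n) : fderiv ℂ F₁ q X = WithLp.toLp 2
      (((s / (5 * R) : ℝ) : ℂ) * fderiv ℂ f q X, (((5 * R)⁻¹ : ℝ) : ℂ) • X) := by
    have hfq' := (hfc.differentiableAt (by simp)).hasFDerivAt
    have h1 := (hfq'.const_mul ((s / (5 * R) : ℝ) : ℂ)).prodMk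
      (((hasFDerivAt_id (𝕜 := ℂ) q).sub_const q).const_smul (((5 * R)⁻¹ : ℝ) : ℂ))
    have h2 := (WithLp.prodContinuousLinearEquiv 2 ℂ ℂ (CSpace n)).symm.hasFDerivAt.comp q h1
    refine (congrArg (fun T => T X) h2.fderiv).trans ?_
    simp
  refine ⟨v, ⟨fun z hz => ⟨?_, hlt z hz⟩, ?_, ?_, ?_⟩, fun X => ?_⟩
  · exact (Real.rpow_nonneg (ht0 z) _).trans (hv_ge z)
  · simpa [hF₁q] using hvq.self_of_nhds
  · exact isPlurisubharmonicOn_log_of_hasHolomorphicSupport hcont hlt hsupp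
  · exact (contDiffAt_norm_sq_of_complex hF₁c).congr_of_eventuallyEq hvq
  · rw [leviForm_congr hvq, leviForm_norm_sq hF₁c hF₁q, hF₁', norm_sq_toLp_mul_smul,
      inv_mul_eq_div]

/-! ### The Riemann map of the slit plane -/

/-- The biholomorphic map of the slit plane onto the unit disc which takes `1` to `0`. -/
noncomputable def slitCayley (ξ : ℂ) : ℂ :=
  (Complex.exp (Complex.log ξ / 2) - 1) / (Complex.exp (Complex.log ξ / 2) + 1)

/-- The argument is halved into `[-π/2, π/2]`. This holds for every `ξ`, also off the slit plane,
where `log 0 = 0`. -/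
theorem re_exp_half_log_nonneg (ξ : ℂ) : 0 ≤ (Complex.exp (Complex.log ξ / 2)).re := by
  rw [Complex.exp_re]
  refine mul_nonneg (Real.exp_pos _).le (Real.cos_nonneg_of_mem_Icc ?_)
  have h1 := Complex.neg_pi_lt_arg ξ
  have h2 := Complex.arg_le_pi ξ
  rw [Complex.div_ofNat_im, Complex.log_im]
  constructor <;> linarith

theorem exp_half_log_add_one_ne_zero (ξ : ℂ) : Complex.exp (Complex.log ξ / 2) + 1 ≠ 0 := by
  intro h
  have h1 := congrArg Complex.re h
  have h2 := re_exp_half_log_nonneg ξ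
  simp only [Complex.add_re, Complex.one_re, Complex.zero_re] at h1
  linarith

theorem norm_slitCayley_le_one (ξ : ℂ) : ‖slitCayley ξ‖ ≤ 1 := by
  have h2 := re_exp_half_log_nonneg ξ
  rw [slitCayley, norm_div]
  refine div_le_one_of_le₀ ?_ (norm_nonneg _)
  rw [← sq_le_sq₀ (norm_nonneg _) (norm_nonneg _), ← Complex.normSq_eq_norm_sq,
    ← Complex.normSq_eq_norm_sq, Complex.normSq_apply, Complex.normSq_apply]
  simp only [Complex.sub_re, Complex.add_re, Complex.sub_im, Complex.add_im, Complex.one_re,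
    Complex.one_im]
  nlinarith

theorem slitCayley_one : slitCayley 1 = 0 := by simp [slitCayley]

theorem contDiffAt_slitCayley {ξ : ℂ} (hξ : ξ ∈ Complex.slitPlane) {m : WithTop ℕ∞} :
    ContDiffAt ℂ m slitCayley ξ := by
  have h : ContDiffAt ℂ m (fun ξ => Complex.exp (Complex.log ξ / 2)) ξ :=
    ((Complex.contDiffAt_log hξ).div_const 2).cexp
  exact (h.sub contDiffAt_const).div (h.add contDiffAt_const) (exp_half_log_add_one_ne_zero ξ)

theorem hasDerivAt_slitCayley_one : HasDerivAt slitCayley (1 / 4) 1 := by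
  have h : HasDerivAt (fun ξ => Complex.exp (Complex.log ξ / 2)) (1 / 2) (1 : ℂ) := by
    have := ((Complex.hasDerivAt_log Complex.one_mem_slitPlane).div_const 2).cexp
    simpa using this
  have h2 := (h.sub_const 1).div (h.add_const 1) (exp_half_log_add_one_ne_zero 1)
  refine h2.congr_deriv ?_
  simp
  norm_num

/-! ### Geometry near a `C¹` boundary point -/

theorem ball_infDist_frontier_subset {E : Type*} [NormedAddCommGroup E] [NormedSpace ℝ E]
    {D : Set E} (hD : IsOpen D) {q : E} (hq : q ∈ D) :
    Metric.ball q (Metric.infDist q (frontier D)) ⊆ D := by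
  rcases (Metric.ball q (Metric.infDist q (frontier D))).eq_empty_or_nonempty with h | h
  · simp [h]
  refine (convex_ball q _).isPreconnected.subset_left_of_subset_union hD
    (isClosed_closure (s := D)).isOpen_compl
    (disjoint_compl_right.mono_left subset_closure) (fun w hw => ?_)
    ⟨q, Metric.mem_ball_self (Metric.nonempty_ball.1 h), hq⟩
  by_contra hwD
  simp only [mem_union, mem_compl_iff, not_or, not_not] at hwD
  have hwf : w ∈ frontier D := by rw [hD.frontier_eq]; exact ⟨hwD.2, hwD.1⟩
  exact (Metric.infDist_le_dist_of_mem hwf).not_gt (by rwa [Metric.mem_ball, dist_comm] at hw)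

/-- The ball about `q` through `y` lies in `D`, so `ρ` cannot increase to first order from `y` into
it: `ℓ u ≤ ℓ (y - q)` whenever `‖u‖ < ‖y - q‖`. -/
theorem norm_mul_le_two_mul_apply {E : Type*} [NormedAddCommGroup E] [NormedSpace ℝ E]
    {D : Set E} (hD : IsOpen D) {q y : E} (hq : q ∈ D) (hy : y ∈ frontier D)
    (hqy : ‖q - y‖ = Metric.infDist q (frontier D)) {ρ : E → ℝ} {ℓ : E →L[ℝ] ℝ}
    (hρ : HasFDerivAt ρ ℓ y) (hneg : ∀ᶠ z in 𝓝 y, z ∈ D ↔ ρ z < 0) :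
    ‖ℓ‖ * ‖y - q‖ ≤ 2 * ℓ (y - q) := by
  have hyD : y ∉ D := by
    rw [hD.frontier_eq] at hy; exact hy.2
  have hρy : 0 ≤ ρ y := not_lt.1 fun h => hyD (hneg.self_of_nhds.2 h)
  have hδ : 0 < ‖y - q‖ := norm_pos_iff.2 (sub_ne_zero.2 fun h => hyD (h ▸ hq))
  set e := y - q with he
  have key (u : E) (hu : ‖u‖ < ‖e‖) : ℓ u ≤ ℓ e := by
    have hline : HasDerivAt (fun t : ℝ => ρ (y + t • (u - e))) (ℓ (u - e)) 0 := by
      have h1 : HasDerivAt (fun t : ℝ => y + t • (u - e)) (u - e) 0 := by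
        simpa using ((hasDerivAt_id (0 : ℝ)).smul_const (u - e)).const_add y
      have h2 : HasFDerivAt ρ ℓ (y + (0 : ℝ) • (u - e)) := by simpa using hρ
      exact h2.comp_hasDerivAt 0 h1
    have hcont : Tendsto (fun t : ℝ => y + t • (u - e)) (𝓝[>] 0) (𝓝 y) := by
      have : Continuous fun t : ℝ => y + t • (u - e) := by fun_prop
      simpa using (this.tendsto 0).mono_left nhdsWithin_le_nhds
    have hle : ℓ (u - e) ≤ 0 := by
      refine le_of_tendsto hline.tendsto_slope_zero_right ?_
      filter_upwards [hcont.eventually hneg, self_mem_nhdsWithin,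
        (eventually_lt_nhds (zero_lt_one (α := ℝ))).filter_mono nhdsWithin_le_nhds]
        with t h1 (h2 : 0 < t) h3
      have hmem : y + t • (u - e) ∈ D := by
        refine ball_infDist_frontier_subset hD hq ?_
        rw [← hqy, Metric.mem_ball, dist_eq_norm, norm_sub_rev q y, ← he]
        have : y + t • (u - e) - q = (1 - t) • e + t • u := by
          rw [he]; module
        rw [this]
        calc _ ≤ ‖(1 - t) • e‖ + ‖t • u‖ := norm_add_le _ _
          _ = (1 - t) * ‖e‖ + t * ‖u‖ := by
            rw [norm_smul, norm_smul, Real.norm_of_nonneg (by linarith), Real.norm_of_nonneg h2.le]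
          _ < (1 - t) * ‖e‖ + t * ‖e‖ := by gcongr
          _ = ‖e‖ := by ring
      have h4 := h1.1 hmem
      rw [zero_add, zero_smul, add_zero, smul_eq_mul]
      exact mul_nonpos_of_nonneg_of_nonpos (by positivity) (by linarith)
    simpa using hle
  have hbound : ‖ℓ‖ ≤ 2 * ℓ e / ‖e‖ := by
    have hℓe : 0 ≤ ℓ e := by simpa using key 0 (by simpa using hδ)
    refine ℓ.opNorm_le_bound (by positivity) fun x => ?_
    rcases eq_or_ne x 0 with rfl | hx
    · simp
    have hx' : 0 < ‖x‖ := norm_pos_iff.2 hx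
    have h1 (σ : ℝ) (hσ : |σ| = 1) : σ * ℓ x * (‖e‖ / (2 * ‖x‖)) ≤ ℓ e := by
      -- A test vector of norm `‖e‖ / 2` avoids a limit and costs the factor `2`.
      have := key ((σ * (‖e‖ / (2 * ‖x‖))) • x) (by
        rw [norm_smul, norm_mul, Real.norm_eq_abs, hσ, Real.norm_of_nonneg (by positivity)]
        field_simp
        linarith)
      rw [map_smul, smul_eq_mul] at this
      linarith
    have h2 : |ℓ x| * (‖e‖ / (2 * ‖x‖)) ≤ ℓ e := by
      rcases abs_choice (ℓ x) with h | h
      · rw [h]; simpa using h1 1 (by simp)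
      · rw [h]; simpa using h1 (-1) (by simp)
    rw [Real.norm_eq_abs]
    calc |ℓ x| = |ℓ x| * (‖e‖ / (2 * ‖x‖)) * (2 * ‖x‖ / ‖e‖) := by field_simp
      _ ≤ ℓ e * (2 * ‖x‖ / ‖e‖) := by gcongr
      _ = _ := by ring
  rwa [le_div_iff₀ hδ] at hbound

/-- Near a `C¹` boundary point, `D` is invariant under translation by negative multiples of the
vector from a point of `D` to a nearest boundary point. -/
theorem exists_ball_translate_mem {n : ℕ} {D : Set (CSpace n)} (hD : IsOpen D) {p : CSpace n}
    (hp : p ∈ frontier D) (hC1 : HasC1BoundaryNear D p) :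
    ∃ r : ℝ, 0 < r ∧ ∀ q ∈ D, q ∈ Metric.ball p r → ∀ y ∈ frontier D, ‖q - y‖ = bdryDist D q →
      ∀ z ∈ D, z ∈ Metric.ball p (2 * r) → ∀ m : ℝ, 0 ≤ m →
        z - m • (y - q) ∈ Metric.ball p (2 * r) → z - m • (y - q) ∈ D := by
  obtain ⟨U, ρ, hU, hpU, hρ, hne, hDU⟩ := hC1
  have hmem {z} (hz : z ∈ U) : z ∈ D ↔ ρ z < 0 := by
    have := Set.ext_iff.1 hDU z
    simp only [mem_inter_iff, hz, and_true, true_and, mem_ofPred_eq] at this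
    exact this
  have hdiff {z} (hz : z ∈ U) : DifferentiableAt ℝ ρ z :=
    (hρ.differentiableOn one_ne_zero).differentiableAt (hU.mem_nhds hz)
  have hc : ContinuousAt (fderiv ℝ ρ) p :=
    (hρ.continuousOn_fderiv_of_isOpen hU le_rfl).continuousAt (hU.mem_nhds hpU)
  set G := ‖fderiv ℝ ρ p‖ with hG
  have hG0 : 0 < G := norm_pos_iff.2 (hne p hpU)
  -- On this ball `dρ` oscillates by at most `G/4`, while `dρ_y (y - q) ≥ (7/16) G ‖y - q‖`; so `dρ
  -- (y - q) ≥ 0` throughout and `ρ` decreases along `-(y - q)`.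
  obtain ⟨r, hr, hball⟩ : ∃ r : ℝ, 0 < r ∧ ∀ z ∈ Metric.ball p (2 * r),
      z ∈ U ∧ ‖fderiv ℝ ρ z - fderiv ℝ ρ p‖ < G / 8 := by
    have h1 : ∀ᶠ z in 𝓝 p, z ∈ U ∧ ‖fderiv ℝ ρ z - fderiv ℝ ρ p‖ < G / 8 := by
      refine (hU.eventually_mem hpU).and ?_
      have := hc.eventually (Metric.ball_mem_nhds _ (show 0 < G / 8 by positivity))
      simpa only [Metric.mem_ball, dist_eq_norm] using this
    obtain ⟨r, hr, h⟩ := Metric.eventually_nhds_iff_ball.1 h1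
    exact ⟨r / 2, by positivity, fun z hz => h z (by rwa [mul_div_cancel₀ _ two_ne_zero] at hz)⟩
  refine ⟨r, hr, fun q hq hqr y hy hqy z hz hzr m hm hzm => ?_⟩
  have hyr : y ∈ Metric.ball p (2 * r) := by
    have h1 : ‖q - y‖ ≤ dist q p := hqy ▸ Metric.infDist_le_dist_of_mem hp
    rw [Metric.mem_ball] at hqr ⊢
    have h2 := dist_triangle y q p
    rw [dist_comm y q, dist_eq_norm q y] at h2
    linarith
  have hyU := (hball y hyr).1
  have hpos (w) (hw : w ∈ Metric.ball p (2 * r)) : 0 ≤ fderiv ℝ ρ w (y - q) := by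
    have h1 := norm_mul_le_two_mul_apply hD hq hy hqy (hdiff hyU).hasFDerivAt
      ((hU.eventually_mem hyU).mono fun z hz => hmem hz)
    have h2 : G - ‖fderiv ℝ ρ y‖ < G / 8 := by
      refine lt_of_le_of_lt ?_ (hball y hyr).2
      rw [norm_sub_rev]
      exact norm_sub_norm_le _ _
    have h3 : ‖fderiv ℝ ρ w - fderiv ℝ ρ y‖ ≤ G / 4 := by
      have := norm_sub_le (fderiv ℝ ρ w - fderiv ℝ ρ p) (fderiv ℝ ρ y - fderiv ℝ ρ p)
      rw [sub_sub_sub_cancel_right] at this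
      linarith [(hball y hyr).2, (hball w hw).2]
    have h4 := (fderiv ℝ ρ w - fderiv ℝ ρ y).le_opNorm (y - q)
    rw [Real.norm_eq_abs] at h4
    have h5 := (abs_le.1 h4).1
    rw [sub_apply] at h5
    have h6 : 0 ≤ ‖y - q‖ := norm_nonneg _
    nlinarith
  have hseg (t : ℝ) (ht : t ∈ Icc 0 m) : z - t • (y - q) ∈ Metric.ball p (2 * r) := by
    rcases hm.eq_or_lt with rfl | hm'
    · obtain rfl : t = 0 := le_antisymm ht.2 ht.1
      exact hzm
    have := (convex_ball p (2 * r)) hzr hzm (a := 1 - t / m) (b := t / m)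
      (sub_nonneg.2 (div_le_one_of_le₀ ht.2 hm)) (div_nonneg ht.1 hm) (by ring)
    convert this using 1
    rw [smul_sub (t / m), smul_smul, div_mul_cancel₀ _ hm'.ne']
    module
  have hder (t : ℝ) (ht : t ∈ Icc 0 m) : HasDerivAt (fun t : ℝ => ρ (z - t • (y - q)))
      (-fderiv ℝ ρ (z - t • (y - q)) (y - q)) t := by
    have h1 : HasDerivAt (fun t : ℝ => z - t • (y - q)) (-(y - q)) t := by
      simpa using ((hasDerivAt_id t).smul_const (y - q)).const_sub z
    rw [← map_neg]
    exact (hdiff (hball _ (hseg t ht)).1).hasFDerivAt.comp_hasDerivAt t h1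
  have hanti : AntitoneOn (fun t : ℝ => ρ (z - t • (y - q))) (Icc 0 m) := by
    refine antitoneOn_of_deriv_nonpos (convex_Icc 0 m)
      (fun t ht => (hder t ht).continuousAt.continuousWithinAt)
      (fun t ht => (hder t (interior_subset ht)).differentiableAt.differentiableWithinAt)
      fun t ht => ?_
    rw [(hder t (interior_subset ht)).deriv]
    exact neg_nonpos.2 (hpos _ (hseg t (interior_subset ht)))
  have h1 := hanti (left_mem_Icc.2 hm) (right_mem_Icc.2 hm) hm
  simp only [zero_smul, sub_zero] at h1
  exact (hmem (hball _ hzm).1).2 (h1.trans_lt ((hmem (hball _ hzr).1).1 hz))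

/-- The coordinate along `y - q` which vanishes on the hyperplane `H_{q*}` and is `1` at `q` does
not take values in `(-∞, 0]` near `q`, at distances less than `δ*`. -/
theorem one_sub_inner_mem_slitPlane {n : ℕ} {D : Set (CSpace n)} {q y z : CSpace n}
    {B : Set (CSpace n)} {s : ℝ} (hs : s ≤ starDist D q y) (hB : Metric.ball q s ⊆ B) (hy : y ≠ q)
    (htrans : ∀ z ∈ D, z ∈ B → ∀ m : ℝ, 0 ≤ m → z - m • (y - q) ∈ B → z - m • (y - q) ∈ D)
    (hz : z ∈ D) (hzq : z ∈ Metric.ball q s) :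
    1 - inner ℂ (y - q) (z - q) / ((2 * ‖y - q‖ ^ 2 : ℝ) : ℂ) ∈ Complex.slitPlane := by
  set e := y - q with he
  set a := inner ℂ e (z - q) with ha
  have hδ : 0 < ‖e‖ := norm_pos_iff.2 (sub_ne_zero.2 hy)
  by_contra hslit
  simp only [Complex.mem_slitPlane_iff, not_or, not_lt, not_not, Complex.sub_re, Complex.one_re,
    Complex.div_ofReal_re, Complex.sub_im, Complex.one_im, Complex.div_ofReal_im, zero_sub,
    neg_eq_zero] at hslit
  obtain ⟨hre, him⟩ := hslit
  have hdpos : 0 < 2 * ‖e‖ ^ 2 := by positivity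
  have him' : a.im = 0 := by
    rcases div_eq_zero_iff.1 him with h | h
    · exact h
    · exact absurd h hdpos.ne'
  have hre' : 2 * ‖e‖ ^ 2 ≤ a.re := by
    rw [sub_nonpos, one_le_div hdpos] at hre
    exact hre
  -- As `q* = q + 2e`, moving by `-m e` brings the coefficient of `e` in `z - q` from `m + 2` to
  -- `2`, that is, into `H_{q*}`. The orthogonal part `w` is then the offset from `q*`.
  set m := a.re / ‖e‖ ^ 2 - 2 with hm
  have hm0 : 0 ≤ m := by
    rw [hm, sub_nonneg, le_div_iff₀ (by positivity)]
    exact hre'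
  set w := z - q - (m + 2) • e with hw
  have hew : inner ℂ e w = 0 := by
    have h1 : (m + 2) • e = ((m + 2 : ℝ) : ℂ) • e := (Complex.coe_smul _ _).symm
    rw [hw, inner_sub_right, ← ha, h1, inner_smul_right, inner_self_eq_norm_sq_to_K]
    apply Complex.ext
    · simp only [Complex.coe_algebraMap, ← Complex.ofReal_pow, ← Complex.ofReal_mul,
        Complex.sub_re, Complex.ofReal_re, Complex.zero_re, hm]
      field_simp
      ring
    · simp only [Complex.coe_algebraMap, ← Complex.ofReal_pow, ← Complex.ofReal_mul,
        Complex.sub_im, Complex.ofReal_im, Complex.zero_im, him', sub_zero]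
  have hpyth (t : ℝ) : ‖w + t • e‖ ^ 2 = ‖w‖ ^ 2 + t ^ 2 * ‖e‖ ^ 2 := by
    have h1 : t • e = ((t : ℝ) : ℂ) • e := (Complex.coe_smul _ _).symm
    have h2 : inner ℂ w (t • e) = 0 := by
      rw [h1, inner_smul_right, inner_eq_zero_symm.1 hew, mul_zero]
    have h3 := norm_add_sq_eq_norm_sq_add_norm_sq_of_inner_eq_zero (𝕜 := ℂ) w (t • e) h2
    rw [norm_smul, Real.norm_eq_abs] at h3
    rw [sq, h3, ← sq_abs t]
    ring
  have hzq' : z - q = w + (m + 2) • e := by rw [hw]; abel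
  have hlt : ‖z - q‖ < s := by rwa [Metric.mem_ball, dist_eq_norm] at hzq
  have hws : ‖w‖ < s := by
    refine lt_of_le_of_lt ?_ hlt
    rw [← sq_le_sq₀ (norm_nonneg _) (norm_nonneg _), hzq', hpyth]
    have : 0 ≤ (m + 2) ^ 2 * ‖e‖ ^ 2 := by positivity
    linarith
  have hz' : z - m • e - q = w + (2 : ℝ) • e := by rw [hw]; module
  have hz's : ‖z - m • e - q‖ < s := by
    refine lt_of_le_of_lt ?_ hlt
    rw [← sq_le_sq₀ (norm_nonneg _) (norm_nonneg _), hzq', hpyth, hz', hpyth]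
    gcongr
    linarith
  have hzD : z - m • e ∈ D :=
    htrans z hz (hB hzq) m hm0 (hB (by rwa [Metric.mem_ball, dist_eq_norm]))
  have hstar : z - m • e - reflectedPoint q y = w := by
    have h2 : (2 : ℂ) • y = y + y := two_smul ℂ y
    rw [reflectedPoint, h2, hw, he]
    module
  have hH : z - m • e ∈ closure D ∩ reflectedHyperplane q y := by
    refine ⟨subset_closure hzD, ?_⟩
    rw [reflectedHyperplane, mem_ofPred_eq, hstar, normalLine,
      Submodule.mem_orthogonal_singleton_iff_inner_right]
    exact hew
  have h1 : ENNReal.ofReal (starDist D q y) ≤ ENNReal.ofReal ‖w‖ := by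
    rw [starDist, ENNReal.ofReal_toReal (ne_top_of_le_ne_top ENNReal.one_ne_top (min_le_left _ _))]
    refine (min_le_right _ _).trans ((Metric.infEDist_le_edist_of_mem hH).trans_eq ?_)
    rw [edist_comm, edist_dist, dist_eq_norm, hstar]
  rw [ENNReal.ofReal_le_ofReal_iff (norm_nonneg _)] at h1
  linarith

/-! ### The lower bound for the Sibony metric -/

theorem norm_starProjection_normalLine {n : ℕ} (q y X : CSpace n) :
    ‖(normalLine q y).starProjection X‖ = ‖inner ℂ (y - q) X‖ / ‖y - q‖ := by
  rw [normalLine, Submodule.starProjection_singleton, norm_smul, norm_div,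
    RCLike.norm_ofReal, abs_of_nonneg (by positivity)]
  rcases eq_or_ne (‖y - q‖) 0 with h | h
  · simp [h]
  · field_simp

theorem starDist_nonneg {n : ℕ} (D : Set (CSpace n)) (q y : CSpace n) : 0 ≤ starDist D q y :=
  ENNReal.toReal_nonneg

theorem starDist_le_one {n : ℕ} (D : Set (CSpace n)) (q y : CSpace n) : starDist D q y ≤ 1 :=
  ENNReal.toReal_le_of_le_ofReal zero_le_one (by simp)

theorem exists_mem_sibonyClass_le_sqrt_leviForm {n : ℕ} {D : Set (CSpace n)} (hD : IsOpen D)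
    {q y : CSpace n} (hy : y ≠ q) {B : Set (CSpace n)} {R c₀ : ℝ} (hR1 : 1 ≤ R)
    (hR : ∀ z ∈ D, ‖z - q‖ < R) (hc₀ : 0 < c₀) (hc₁ : c₀ ≤ 1) (hB : Metric.ball q c₀ ⊆ B)
    (htrans : ∀ z ∈ D, z ∈ B → ∀ m : ℝ, 0 ≤ m → z - m • (y - q) ∈ B → z - m • (y - q) ∈ D) :
    ∃ v ∈ sibonyClass D q, ∀ X : CSpace n,
      c₀ / (80 * R) * (starDist D q y / ‖y - q‖ * ‖(normalLine q y).starProjection X‖ + ‖X‖)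
        ≤ √(leviForm v q X) := by
  have hδ : 0 < ‖y - q‖ := norm_pos_iff.2 (sub_ne_zero.2 hy)
  have hR0 : 0 < R := one_pos.trans_le hR1
  rcases (starDist_nonneg D q y).eq_or_lt with h0 | h0
  -- For `δ* = 0` no ball is available, but only the term `‖X‖` is needed, and `f = 0` provides it.
  · obtain ⟨v, hv, hL⟩ := exists_mem_sibonyClass hD hR zero_lt_one hR1
      (f := fun _ => 0) (differentiableOn_const 0) (by simp) rfl contDiffAt_const
    refine ⟨v, hv, fun X => Real.le_sqrt_of_sq_le ?_⟩
    rw [hL, ← h0, zero_div, zero_mul, zero_add]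
    refine le_add_of_nonneg_of_le (sq_nonneg _) ?_
    have : c₀ / (80 * R) * ‖X‖ ≤ ‖X‖ / (5 * R) := by
      calc c₀ / (80 * R) * ‖X‖ ≤ 1 / (5 * R) * ‖X‖ := by gcongr; norm_num
        _ = _ := by ring
    gcongr
  · set s := c₀ * starDist D q y with hs
    have hs0 : 0 < s := mul_pos hc₀ h0
    have hsc : s ≤ c₀ := mul_le_of_le_one_right hc₀.le (starDist_le_one D q y)
    have hsd : s ≤ starDist D q y := mul_le_of_le_one_left h0.le hc₁
    have hsB : Metric.ball q s ⊆ B := (Metric.ball_subset_ball hsc).trans hB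
    let A : CSpace n →L[ℂ] ℂ := (((2 * ‖y - q‖ ^ 2 : ℝ) : ℂ))⁻¹ • innerSL ℂ (y - q)
    have hA (X : CSpace n) : A X = inner ℂ (y - q) X / ((2 * ‖y - q‖ ^ 2 : ℝ) : ℂ) := by
      simp only [A, smul_apply, innerSL_apply_apply, smul_eq_mul]
      rw [inv_mul_eq_div]
    have hslit {z} (hz : z ∈ D ∩ Metric.ball q s) : 1 - A (z - q) ∈ Complex.slitPlane := by
      rw [hA]
      exact one_sub_inner_mem_slitPlane hsd hsB hy htrans hz.1 hz.2
    have hAd (z : CSpace n) : HasFDerivAt (fun z => 1 - A (z - q)) (-A) z := by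
      have h1 := (A.hasFDerivAt (x := z - q)).comp z ((hasFDerivAt_id z).sub_const q)
      exact h1.const_sub 1
    have hqq : (1 : ℂ) - A (q - q) = 1 := by simp
    have hAc : ContDiff ℂ 2 fun z => 1 - A (z - q) :=
      contDiff_const.sub (A.contDiff.comp (contDiff_id.sub contDiff_const))
    obtain ⟨v, hv, hL⟩ := exists_mem_sibonyClass hD hR hs0 (hsc.trans (hc₁.trans hR1))
      (f := fun z => slitCayley (1 - A (z - q)))
      (fun z hz => (DifferentiableAt.comp z (g := slitCayley)
        ((contDiffAt_slitCayley (m := 1) (hslit hz)).differentiableAt one_ne_zero)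
        (hAd z).differentiableAt).differentiableWithinAt)
      (fun z _ => norm_slitCayley_le_one _) (by rw [hqq, slitCayley_one])
      ((contDiffAt_slitCayley (by rw [hqq]; exact Complex.one_mem_slitPlane)).comp q
        hAc.contDiffAt)
    refine ⟨v, hv, fun X => Real.le_sqrt_of_sq_le ?_⟩
    have hfd : ‖fderiv ℂ (fun z => slitCayley (1 - A (z - q))) q X‖ =
        ‖(normalLine q y).starProjection X‖ / (8 * ‖y - q‖) := by
      have h1 : HasDerivAt slitCayley (1 / 4) (1 - A (q - q)) := by
        rw [hqq]; exact hasDerivAt_slitCayley_one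
      have h2 : HasFDerivAt (fun z => slitCayley (1 - A (z - q))) ((1 / 4 : ℂ) • -A) q :=
        HasDerivAt.comp_hasFDerivAt (h₂ := slitCayley) q h1 (hAd q)
      rw [h2.fderiv, norm_starProjection_normalLine, smul_apply, neg_apply, hA, norm_smul, norm_neg,
        norm_div (inner ℂ (y - q) X), Complex.norm_real, Real.norm_of_nonneg (by positivity)]
      norm_num
      field_simp
      ring
    rw [hL, hfd]
    set x := ‖(normalLine q y).starProjection X‖
    have e1 : s / (5 * R) * (x / (8 * ‖y - q‖)) =
        2 * (c₀ / (80 * R) * (starDist D q y / ‖y - q‖ * x)) := by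
      rw [hs]; field_simp; ring
    have e2 : 2 * (c₀ / (80 * R) * ‖X‖) ≤ ‖X‖ / (5 * R) := by
      calc 2 * (c₀ / (80 * R) * ‖X‖) ≤ 2 * (1 / (80 * R) * ‖X‖) := by gcongr
        _ = 1 / (40 * R) * ‖X‖ := by field_simp; ring
        _ ≤ 1 / (5 * R) * ‖X‖ := by gcongr; norm_num
        _ = _ := by ring
    have e3 : 0 ≤ 2 * (c₀ / (80 * R) * ‖X‖) := by positivity
    have e4 := pow_le_pow_left₀ e3 e2 2
    rw [e1, mul_add]
    -- This is `(a + b)² ≤ (2a)² + (2b)²`.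
    nlinarith [sq_nonneg (c₀ / (80 * R) * (starDist D q y / ‖y - q‖ * x) - c₀ / (80 * R) * ‖X‖)]

theorem proposition7 (n : ℕ) (D : Set (CSpace n)) (hDo : IsOpen D) (hDc : IsConnected D)
    (hDb : Bornology.IsBounded D) (p : CSpace n) (hp : p ∈ frontier D)
    (hC1 : HasC1BoundaryNear D p) :
    ∃ c : ℝ, 0 < c ∧ ∀ᶠ q in 𝓝[D] p, ∀ pq ∈ frontier D, ‖q - pq‖ = bdryDist D q →
      ∀ X : CSpace n,
        ENNReal.ofReal (starDist D q pq / bdryDist D q * ‖(normalLine q pq).starProjection X‖ + ‖X‖)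
          ≤ ENNReal.ofReal c * sibonyMetric D q X := by
  obtain ⟨r, hr, htrans⟩ := exists_ball_translate_mem hDo hp hC1
  set R := Metric.diam D + 1 with hR
  have hR1 : 1 ≤ R := le_add_of_nonneg_left Metric.diam_nonneg
  have hR0 : 0 < R := one_pos.trans_le hR1
  -- Radius at most `r` keeps the ball about `q` inside `B(p, 2r)`; the bound `1` ensures `s ≤ δ*`.
  have hc₀ : 0 < min 1 r := lt_min one_pos hr
  refine ⟨80 * R / min 1 r, by positivity, ?_⟩
  filter_upwards [self_mem_nhdsWithin,
    mem_nhdsWithin_of_mem_nhds (Metric.ball_mem_nhds p hr)] with q hq hqr y hy hqy X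
  have hyq : y ≠ q := by
    rintro rfl
    rw [hDo.frontier_eq] at hy
    exact hy.2 hq
  obtain ⟨v, hv, hL⟩ := exists_mem_sibonyClass_le_sqrt_leviForm hDo hyq
    (B := Metric.ball p (2 * r)) hR1
    (fun z hz => by
      rw [← dist_eq_norm]
      exact (Metric.dist_le_diam_of_mem hDb hz hq).trans_lt (lt_add_one _))
    hc₀ (min_le_left _ _)
    (Metric.ball_subset_ball' (by
      rw [Metric.mem_ball] at hqr
      linarith [min_le_right 1 r]))
    (htrans q hq hqr y hy hqy)
  have h1 : ENNReal.ofReal (√(leviForm v q X)) ≤ sibonyMetric D q X :=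
    le_iSup₂ (f := fun v _ => ENNReal.ofReal (√(leviForm v q X))) v hv
  refine le_trans ?_ (mul_le_mul_right h1 _)
  rw [← ENNReal.ofReal_mul (by positivity), ← hqy, norm_sub_rev q y]
  refine ENNReal.ofReal_le_ofReal ?_
  rw [← div_le_iff₀' (by positivity)]
  refine le_of_eq_of_le ?_ (hL X)
  field_simp
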